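/- All graphs are finite and simple. Let $G$ be a graph with vertex set $V$, edge set $E$ and $n=|V|$, and let $k$ be a non-negative integer. For a vertex weighting $\omega\colon V\to\mathbb{R}$ and an edge labeling $f\colon E\to\mathbb{R}$, the weighted vertex sum at a vertex $v$ is $\omega(v)+\sum_{e\ni v} f(e)$. The graph $G$ is $k$-list-weighted-antimagic if for every $\omega\colon V\to\mathbb{R}$ and every assignment $L\colon E\to 2^{\mathbb{R}}$ of (possibly infinite) lists with $|L(e)|\ge |E|+k$ for all $e\in E$, there is an injective labeling $f\colon E\to\mathbb{R}$ with $f(e)\in L(e)$ for all $e\in E$ such that the weighted vertex sums at any two distinct vertices are different. It is $k$-list-weighted-quasi-antimagic if for all such $\omega$ and $L$ there is an injective labeling $f$ with $f(e)\in L(e)$ for all $e\in E$ such that the weighted vertex sums at $u$ and $v$ are different for any two distinct non-isolated vertices $u,v$ that are not the two vertices of a $K_2$ component of $G$. Theorem. (a) Every graph on $n$ vertices is $\lfloor 4n/3\rfloor$-list-weighted-quasi-antimagic. (b) Every graph on $n$ vertices, connected or not, that has no connected component isomorphic to $K_1$ or $K_2$ is $\lfloor 4n/3\rfloor$-list-weighted-antimagic.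 -/

import Mathlib

namespace SimpleGraph

/-- The connected component `c` is a copy of the complete graph `K_r`. -/
def ConnectedComponent.IsCompleteComponent {V : Type*} {G : SimpleGraph V}
    (c : G.ConnectedComponent) (r : ℕ) : Prop :=
  Nonempty (c.toSimpleGraph ≃g completeGraph (Fin r))

open Classical in
/-- The weighted vertex sum at `v`: the weight of `v` plus the sum of the labels of the edges
incident to `v`. -/
noncomputable def weightedVertexSum {V : Type*} [Fintype V] (G : SimpleGraph V)
    (ω : V → ℝ) (f : G.edgeSet → ℝ) (v : V) : ℝ :=
  ω v + ∑ e ∈ (Finset.univ : Finset G.edgeSet).filter (fun e => v ∈ e.1), f e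

/-- `G` is `k`-list-weighted-antimagic. Lists are arbitrary, possibly infinite, sets of reals. -/
def IsListWeightedAntimagic {V : Type*} [Fintype V] (G : SimpleGraph V) (k : ℕ) : Prop :=
  ∀ (ω : V → ℝ) (L : G.edgeSet → Set ℝ),
    (∀ e, ((G.edgeSet.ncard + k : ℕ) : ℕ∞) ≤ (L e).encard) →
      ∃ f : G.edgeSet → ℝ, (∀ e, f e ∈ L e) ∧ Function.Injective f ∧
        ∀ u v : V, u ≠ v → G.weightedVertexSum ω f u ≠ G.weightedVertexSum ω f v

/-- `G` is `k`-list-weighted-quasi-antimagic: weighted vertex sums are only required to differ for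
pairs of non-isolated vertices that are not the two vertices of a `K_2` component. -/
def IsListWeightedQuasiAntimagic {V : Type*} [Fintype V] (G : SimpleGraph V) (k : ℕ) : Prop :=
  ∀ (ω : V → ℝ) (L : G.edgeSet → Set ℝ),
    (∀ e, ((G.edgeSet.ncard + k : ℕ) : ℕ∞) ≤ (L e).encard) →
      ∃ f : G.edgeSet → ℝ, (∀ e, f e ∈ L e) ∧ Function.Injective f ∧
        ∀ u v : V, u ≠ v → ¬ G.IsIsolated u → ¬ G.IsIsolated v →
          ¬ (G.Adj u v ∧ (G.connectedComponentMk u).IsCompleteComponent 2) →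
          G.weightedVertexSum ω f u ≠ G.weightedVertexSum ω f v

end SimpleGraph

/-!
The weight of the argument is carried by a spanning star forest and by the order in which its edges
are labelled.

Let `n'` be the number of non-isolated vertices. A minimal edge cover `T` of these vertices is a
forest of stars, each edge `e` of which has a leaf of its own (`exists_isStarCover`); if there are
`p` stars, then `T` has `n' - p` edges. The edges outside `T` are labelled greedily
(`exists_label_outside`). The only care needed is that the two partial sums at a star with a single
edge end up different, since the label of that edge adds equally to both; this is possible unless
the edge is a `K_2` component. What remains is a problem about stars with weighted vertices and
lists of length `|T| + ⌊4n/3⌋` (`exists_good`).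

A greedy labelling of the star forest would be too expensive, because a labelled edge can forbid two
values at an edge `j` not yet labelled for the label and the leaf sum alone. The saving is in the
order: if at every step the edge `i` and the admissible label `x` are chosen to make `x + t i` as
large as possible, for suitable shifts `t`, then two forbidden values of `j` that are symmetric about
`x + t i - t j` cost the list of `j` at most one element, since no element of that list exceeds
`x + t i - t j` (`card_le_card_sdiff_pair`). This is used in two ways, with `l` denoting the weight
of a leaf.

* If `p ≥ n'/3`, one edge of every star is set aside and all others are labelled greedily. Each of
  these costs an edge set aside three values, for its label and for its leaf sum against the two ends.
  The edges set aside are then single edges with end weights `l` and `z`, and with the shift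
  `(l + z) / 2` they cost each other three values instead of five (`exists_good_matching`). The total
  is at most `3 (n' - 2 p) + 3 (p - 1)`.
* If `p < n'/3`, all edges are labelled in one extremal order with shift `l / 2`. Every earlier edge
  costs one value for label and leaf sum together. The sum at a centre is settled by the last edge of
  its star, where it has to avoid the earlier sums. The total is about `2 n'`, independently of `p`
  (`exists_good_of_admissible`).

Both totals stay below `n' - p + ⌊4n/3⌋` in their ranges.
-/

namespace StarForest

open Finset

/-! ### Greedy choice avoiding finitely many affine conditions -/

/-- Label the elements of `S` one at a time. A condition `b q + ∑ e ∈ S, a q e * x e ≠ 0` is taken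
care of when the last element of `S` with a nonzero coefficient in it is labelled. -/
theorem exists_greedy {ι β : Type*} [DecidableEq ι] (L : ι → Finset ℝ) (Γ : Finset (ι → ℝ))
    (Q : Finset β) (a : β → ι → ℝ) (b : β → ℝ) (S : Finset ι)
    (h : ∀ e ∈ S, #Γ * #S + #{q ∈ Q | a q e ≠ 0} < #(L e)) :
    ∃ x : ι → ℝ, (∀ e ∈ S, x e ∈ L e) ∧
      (∀ s ∈ Γ, Set.InjOn (fun e => x e + s e) S) ∧
      ∀ q ∈ Q, (∃ e ∈ S, a q e ≠ 0) → b q + ∑ e ∈ S, a q e * x e ≠ 0 := by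
  induction S using Finset.induction_on with
  | empty => exact ⟨fun _ => 0, by simp⟩
  | insert e S he ih =>
    obtain ⟨x, hxL, hxΓ, hxQ⟩ := ih fun e' he' => by
      refine lt_of_le_of_lt ?_ (h e' (mem_insert_of_mem he'))
      gcongr
      exact subset_insert _ _
    let bad : Finset ℝ := (Γ ×ˢ S).image (fun p => x p.2 + p.1 p.2 - p.1 e) ∪
      {q ∈ Q | a q e ≠ 0}.image (fun q => -(b q + ∑ e' ∈ S, a q e' * x e') / a q e)
    have hbad : #bad < #(L e) := by
      have h1 := h e (mem_insert_self _ _)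
      have h2 : #bad ≤ #Γ * #S + #{q ∈ Q | a q e ≠ 0} :=
        (card_union_le _ _).trans
          (add_le_add (card_image_le.trans (card_product _ _).le) card_image_le)
      have h3 : #Γ * #S ≤ #Γ * #(insert e S) :=
        Nat.mul_le_mul_left _ (card_le_card (subset_insert _ _))
      omega
    obtain ⟨v, hvL, hvb⟩ := exists_mem_notMem_of_card_lt_card hbad
    have hne : ∀ e' ∈ S, e' ≠ e := fun e' h' => by rintro rfl; exact he h'
    have hup : ∀ e' ∈ S, Function.update x e v e' = x e' := fun e' h' => by
      simp [hne e' h']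
    have hv1 : ∀ s ∈ Γ, ∀ e' ∈ S, v + s e ≠ x e' + s e' := by
      intro s hs e' he' heq
      refine hvb (mem_union_left _ (mem_image.2 ⟨(s, e'), mem_product.2 ⟨hs, he'⟩, ?_⟩))
      simp only
      linarith
    refine ⟨Function.update x e v, ?_, ?_, ?_⟩
    · intro e' he'
      rcases mem_insert.1 he' with rfl | h'
      · simpa using hvL
      · rw [hup e' h']; exact hxL e' h'
    · intro s hs e₁ h₁ e₂ h₂ heq
      simp only at heq
      rcases mem_insert.1 (mem_coe.1 h₁) with rfl | h₁' <;>
        rcases mem_insert.1 (mem_coe.1 h₂) with rfl | h₂'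
      · rfl
      · rw [hup e₂ h₂', Function.update_self] at heq
        exact absurd heq (hv1 s hs e₂ h₂')
      · rw [hup e₁ h₁', Function.update_self] at heq
        exact absurd heq.symm (hv1 s hs e₁ h₁')
      · rw [hup e₁ h₁', hup e₂ h₂'] at heq
        exact hxΓ s hs h₁' h₂' heq
    · intro q hq hex
      rw [sum_insert he, Function.update_self,
        sum_congr rfl fun e' he' => by rw [hup e' he']]
      by_cases hae : a q e = 0
      · obtain ⟨e', he', hae'⟩ := hex
        have he'S : e' ∈ S := by
          rcases mem_insert.1 he' with rfl | h'
          · exact absurd hae hae'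
          · exact h'
        simpa [hae] using hxQ q hq ⟨e', he'S, hae'⟩
      · intro heq
        refine hvb (mem_union_right _ (mem_image.2 ⟨q, mem_filter.2 ⟨hq, hae⟩, ?_⟩))
        field_simp
        linarith

/-! ### The extremal choice -/

/-- Two forbidden values symmetric about an upper bound of a list cost it at most one element. -/
theorem card_le_card_sdiff_pair {A : Finset ℝ} {a b m : ℝ} (hA : ∀ x ∈ A, x ≤ m)
    (hab : a + b = 2 * m) : #A ≤ #(A \ {a, b}) + 1 := by
  have key : ∃ c, A \ {c} ⊆ A \ {a, b} := by
    rcases lt_trichotomy a b with h | h | h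
    · refine ⟨a, fun x hx => ?_⟩
      have := hA x (mem_sdiff.1 hx).1
      simp only [mem_sdiff, mem_singleton, mem_insert, not_or] at hx ⊢
      exact ⟨hx.1, hx.2, by rintro rfl; linarith⟩
    · subst h; exact ⟨a, by simp⟩
    · refine ⟨b, fun x hx => ?_⟩
      have := hA x (mem_sdiff.1 hx).1
      simp only [mem_sdiff, mem_singleton, mem_insert, not_or] at hx ⊢
      exact ⟨hx.1, by rintro rfl; linarith, hx.2⟩
  obtain ⟨c, hc⟩ := key
  have h1 := card_le_card hc
  have h2 := le_card_sdiff {c} A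
  rw [card_singleton] at h2
  omega

/-- Among the elements `x` of nonempty lists `A j`, `j ∈ R`, choose one with `x + t j` largest. -/
theorem exists_max_shift {ι : Type*} {R : Finset ι} {A : ι → Finset ℝ} (t : ι → ℝ)
    (hR : R.Nonempty) (hA : ∀ j ∈ R, (A j).Nonempty) :
    ∃ i ∈ R, ∃ x ∈ A i, ∀ j ∈ R, ∀ y ∈ A j, y ≤ x + t i - t j := by
  obtain ⟨j, hj⟩ := hR
  obtain ⟨y, hy⟩ := hA j hj
  obtain ⟨p, hp, hmax⟩ := (R.sigma A).exists_max_image (fun p => p.2 + t p.1)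
    ⟨⟨j, y⟩, mem_sigma.2 ⟨hj, hy⟩⟩
  rw [mem_sigma] at hp
  refine ⟨p.1, hp.1, p.2, hp.2, fun j hj y hy => ?_⟩
  have := hmax ⟨j, y⟩ (mem_sigma.2 ⟨hj, hy⟩)
  simp only at this
  linarith

/-! ### Good labellings of star forests -/

/-- The labels `x` of the edges `R` of a star forest are good. The edge `j` joins the leaf of
weight `l j` to the centre `c j`, and `W k` is the weight of the centre `k`. The labels are
pairwise distinct, and so are the sums at leaves and centres, except that the sum at the centre of
a star `k` with `Ex k` may coincide with the sum at a leaf of that star. -/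
structure IsGood {ι κ : Type*} [DecidableEq κ] (R : Finset ι) (c : ι → κ) (l : ι → ℝ)
    (W : κ → ℝ) (Ex : κ → Prop) (x : ι → ℝ) : Prop where
  label_injOn : Set.InjOn x R
  leaf_injOn : Set.InjOn (fun j => x j + l j) R
  center_injOn : Set.InjOn (fun k => W k + ∑ j ∈ R with c j = k, x j) (R.image c)
  leaf_center : ∀ j ∈ R, ∀ k ∈ R.image c, x j + l j = W k + ∑ i ∈ R with c i = k, x i →
    c j = k ∧ Ex k

/-! ### Forests of single edges -/

/-- Single edges, the ends of edge `j` having weights `l j` and `z j`. Labelling in decreasing order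
of the midpoint of the two sums, each labelled edge costs every remaining list at most three
elements: one for the label, one for the sums at like ends, one for the sums at unlike ends. -/
theorem exists_good_matching {ι : Type*} [DecidableEq ι] (l z : ι → ℝ) (Ex : ι → Prop)
    (R : Finset ι) (A : ι → Finset ℝ) (hlz : ∀ j ∈ R, l j ≠ z j ∨ Ex j)
    (hA : ∀ j ∈ R, 3 * #R ≤ #(A j) + 2) :
    ∃ x : ι → ℝ, (∀ j ∈ R, x j ∈ A j) ∧ Set.InjOn x R ∧ Set.InjOn (fun j => x j + l j) R ∧
      Set.InjOn (fun j => x j + z j) R ∧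
      ∀ i ∈ R, ∀ j ∈ R, x i + l i = x j + z j → i = j ∧ Ex j := by
  induction hn : #R generalizing R A with
  | zero =>
    rw [card_eq_zero] at hn
    subst hn
    exact ⟨fun _ => 0, by simp⟩
  | succ n ih =>
    have hR : R.Nonempty := card_pos.1 (by omega)
    obtain ⟨i, hi, v, hv, hmax⟩ := exists_max_shift (R := R) (A := A) (fun j => (l j + z j) / 2) hR
      fun j hj => card_pos.1 (by have := hA j hj; omega)
    let A' : ι → Finset ℝ := fun j => ((A j \ {v}) \ {v + l i - l j, v + z i - z j}) \
      {v + l i - z j, v + z i - l j}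
    have hA' : ∀ j ∈ R.erase i, 3 * #(R.erase i) ≤ #(A' j) + 2 := by
      intro j hj
      have hj' := mem_of_mem_erase hj
      have h0 := hA j hj'
      have h1 := le_card_sdiff {v} (A j)
      have h2 := card_le_card_sdiff_pair (A := A j \ {v}) (a := v + l i - l j)
        (b := v + z i - z j) (m := v + (l i + z i) / 2 - (l j + z j) / 2)
        (fun x hx => hmax j hj' x (mem_sdiff.1 hx).1) (by ring)
      have h3 := card_le_card_sdiff_pair
        (A := (A j \ {v}) \ {v + l i - l j, v + z i - z j}) (a := v + l i - z j)
        (b := v + z i - l j) (m := v + (l i + z i) / 2 - (l j + z j) / 2)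
        (fun x hx => hmax j hj' x (mem_sdiff.1 (mem_sdiff.1 hx).1).1) (by ring)
      rw [card_singleton] at h1
      rw [card_erase_of_mem hi]
      simp only [A']
      omega
    obtain ⟨x, hxA, hx1, hx2, hx3, hx4⟩ := ih (R.erase i) A'
      (fun j hj => hlz j (mem_of_mem_erase hj)) hA' (by rw [card_erase_of_mem hi]; omega)
    have hup : ∀ j ∈ R.erase i, Function.update x i v j = x j := fun j hj => by
      simp [ne_of_mem_erase hj]
    have hx : ∀ j ∈ R.erase i, x j ∈ A j ∧ x j ≠ v ∧ x j + l j ≠ v + l i ∧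
        x j + z j ≠ v + z i ∧ x j + z j ≠ v + l i ∧ x j + l j ≠ v + z i := by
      intro j hj
      have := hxA j hj
      simp only [A', mem_sdiff, mem_insert, mem_singleton, not_or] at this
      obtain ⟨⟨⟨h1, h2⟩, h3, h4⟩, h5, h6⟩ := this
      exact ⟨h1, h2, fun h => h3 (by linarith), fun h => h4 (by linarith),
        fun h => h5 (by linarith), fun h => h6 (by linarith)⟩
    have cases : ∀ j ∈ R, j = i ∨ j ∈ R.erase i := fun j hj => by
      rw [mem_erase]; tauto
    have inj : ∀ s : ι → ℝ, Set.InjOn (fun j => x j + s j) (R.erase i) →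
        (∀ j ∈ R.erase i, x j + s j ≠ v + s i) →
        Set.InjOn (fun j => Function.update x i v j + s j) R := by
      intro s hs hne j₁ h₁ j₂ h₂ heq
      simp only at heq
      rcases cases j₁ h₁ with rfl | h₁' <;> rcases cases j₂ h₂ with rfl | h₂'
      · rfl
      · rw [hup j₂ h₂', Function.update_self] at heq
        exact absurd heq.symm (hne _ h₂')
      · rw [hup j₁ h₁', Function.update_self] at heq
        exact absurd heq (hne _ h₁')
      · rw [hup j₁ h₁', hup j₂ h₂'] at heq
        exact hs (mem_coe.2 h₁') (mem_coe.2 h₂') heq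
    refine ⟨Function.update x i v, ?_, ?_, inj l hx2 fun j hj => (hx j hj).2.2.1,
      inj z hx3 fun j hj => (hx j hj).2.2.2.1, ?_⟩
    · intro j hj
      rcases cases j hj with rfl | hj'
      · simpa using hv
      · rw [hup j hj']; exact (hx j hj').1
    · simpa using inj 0 (by simpa using hx1) fun j hj => by simpa using (hx j hj).2.1
    · intro j₁ h₁ j₂ h₂ heq
      rcases cases j₁ h₁ with rfl | h₁' <;> rcases cases j₂ h₂ with rfl | h₂'
      · have : l j₂ = z j₂ := by linarith
        exact ⟨rfl, (hlz j₂ h₂).resolve_left fun h => h this⟩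
      · rw [hup j₂ h₂', Function.update_self] at heq
        exact absurd heq.symm (hx j₂ h₂').2.2.2.2.1
      · rw [hup j₁ h₁', Function.update_self] at heq
        exact absurd heq (hx j₁ h₁').2.2.2.2.2
      · rw [hup j₁ h₁', hup j₂ h₂'] at heq
        exact hx4 j₁ h₁' j₂ h₂' heq

end StarForest

namespace StarForest

open Finset

/-! ### Forests of few stars -/

/-- The extremal labelling of a star forest, in a form suited to induction. `R` is the set of edges
not yet labelled, `W k` the partial sum at the centre `k`, `P` the set of sums already completed,
and `A j` the set of labels still admissible at `j`: an admissible label keeps the sum at the leaf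
of `j`, and also the sum at the centre if `j` is the last edge of its star, away from `P`. If `j` is
one of the last two edges of its star, then it also keeps the sums at the two ends of the other
edge apart.

The edge and the label are chosen with `x + l j / 2` as large as possible. Then a labelled edge
costs every remaining list at most one element for the labels and the sums at leaves together. Every
later sum at a centre costs one element more, and so does every completed sum once `j` has become
the last edge of its star; this is what the bound on the lists expresses. -/
theorem exists_good_of_admissible {ι κ : Type*} [DecidableEq ι] [DecidableEq κ] (c : ι → κ)
    (l : ι → ℝ) (Ex : κ → Prop) (R : Finset ι) (W : κ → ℝ) (P : Finset ℝ) (A : ι → Finset ℝ)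
    (h_leaf : ∀ j ∈ R, ∀ x ∈ A j, x + l j ∉ P)
    (h_center : ∀ j ∈ R, {i ∈ R | c i = c j} = {j} → ∀ x ∈ A j, x + W (c j) ∉ P)
    (h_last : ∀ j ∈ R, {i ∈ R | c i = c j} = {j} → l j ≠ W (c j) ∨ Ex (c j))
    (h_two : ∀ j ∈ R, ∀ i, i ≠ j → {i ∈ R | c i = c j} = {i, j} → ∀ x ∈ A j, W (c j) + x ≠ l i)
    (h_card : ∀ j ∈ R, 2 * (#R + #(R.image c)) + (if #{i ∈ R | c i = c j} = 1 then 0 else #P) +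
      (if 3 ≤ #{i ∈ R | c i = c j} then 1 else 0) ≤ #(A j) + 3) :
    ∃ x : ι → ℝ, (∀ j ∈ R, x j ∈ A j) ∧ IsGood R c l W Ex x ∧
      ∀ k ∈ R.image c, W k + ∑ j ∈ R with c j = k, x j ∉ P := by
  classical
  induction hn : #R generalizing R W P A with
  | zero =>
    rw [card_eq_zero] at hn
    subst hn
    exact ⟨fun _ => 0, by simp, ⟨by simp, by simp, by simp, by simp⟩, by simp⟩
  | succ n ih =>
    have hR : R.Nonempty := card_pos.1 (by omega)
    obtain ⟨i, hi, v, hv, hmax⟩ := exists_max_shift (R := R) (A := A) (fun j => l j / 2) hR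
      fun j hj => by
        have h1 := h_card j hj
        have h2 : 0 < #(R.image c) := card_pos.2 (hR.image c)
        exact card_pos.1 (by omega)
    set R' := R.erase i with hR'
    have hRc : #R' + 1 = #R := card_erase_add_one hi
    have hsub : ∀ j ∈ R', j ∈ R := fun j hj => mem_of_mem_erase hj
    -- The data after labelling `i` with `v`.
    let W' : κ → ℝ := Function.update W (c i) (W (c i) + v)
    have hW'i : W' (c i) = W (c i) + v := Function.update_self ..
    have hW' : ∀ k, k ≠ c i → W' k = W k := fun k hk => Function.update_of_ne hk ..
    -- The edge `i` finishes its star.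
    let fin : Prop := ∀ j ∈ R', c j ≠ c i
    let P' : Finset ℝ :=
      insert (v + l i) (if fin then insert (v + W (c i)) P else P)
    have hP : P ⊆ P' := by
      intro p hp
      simp only [P']
      split_ifs <;> simp [hp]
    have hiP : v + l i ∈ P' := mem_insert_self _ _
    have hiP_center : fin → v + W (c i) ∈ P' := fun h => by simp [P', h]
    let A' : ι → Finset ℝ := fun j => {x ∈ A j | x ≠ v ∧ x + l j ∉ P' ∧
      ({i ∈ R' | c i = c j} = {j} → x + W' (c j) ∉ P') ∧
      ∀ i', i' ≠ j → {i ∈ R' | c i = c j} = {i', j} → W' (c j) + x ≠ l i'}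
    -- Fibres of `c` over centres other than `c i` are unchanged.
    have hfib : ∀ j, c j ≠ c i → {i ∈ R' | c i = c j} = {i ∈ R | c i = c j} := by
      intro j hj
      ext j'
      simp only [mem_filter, R', mem_erase]
      constructor
      · tauto
      · rintro ⟨h1, h2⟩
        exact ⟨⟨by rintro rfl; exact hj h2.symm, h1⟩, h2⟩
    have hfib_i : ∀ j, c j = c i → {i ∈ R | c i = c j} = insert i {i ∈ R' | c i = c j} := by
      intro j hj
      ext j'
      simp only [mem_filter, R', mem_erase, mem_insert]
      constructor
      · rintro ⟨h1, h2⟩; tauto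
      · rintro (rfl | h)
        · exact ⟨hi, hj.symm⟩
        · tauto
    have hi_notMem : ∀ k, i ∉ {i ∈ R' | c i = k} := fun k h => by simp [R'] at h
    have himage : fin → R.image c = insert (c i) (R'.image c) := fun _ => by
      rw [← image_insert, hR', insert_erase hi]
    have himage_card : fin → #(R.image c) = #(R'.image c) + 1 := fun h => by
      rw [himage h, card_insert_of_notMem]
      simp only [mem_image, not_exists, not_and]
      exact h
    have himage' : ¬ fin → R.image c = R'.image c := fun h => by
      simp only [fin, not_forall, not_not] at h
      obtain ⟨j, hj, hji⟩ := h
      rw [← insert_erase hi, image_insert, insert_eq_self.2]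
      exact mem_image.2 ⟨j, hj, hji⟩
    -- Every list loses few elements.
    have hstep : ∀ j ∈ R', ∀ X : Finset ℝ,
        (∀ x ∈ A j, x ≠ v → x ≠ v + l i - l j → x ∉ X → x ∈ A' j) →
        #(A j) ≤ #(A' j) + 1 + #X := by
      intro j hj X hX
      have h1 := card_le_card_sdiff_pair (A := A j) (a := v) (b := v + l i - l j)
        (m := v + l i / 2 - l j / 2) (hmax j (hsub j hj)) (by ring)
      have h2 := le_card_sdiff X (A j \ {v, v + l i - l j})
      have h3 : #((A j \ {v, v + l i - l j}) \ X) ≤ #(A' j) := by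
        refine card_le_card fun x hx => ?_
        simp only [mem_sdiff, mem_insert, mem_singleton, not_or] at hx
        exact hX x hx.1.1 hx.1.2.1 hx.1.2.2 hx.2
      omega
    have hcard' : ∀ j ∈ R', 2 * (#R' + #(R'.image c)) +
        (if #{i ∈ R' | c i = c j} = 1 then 0 else #P') +
        (if 3 ≤ #{i ∈ R' | c i = c j} then 1 else 0) ≤ #(A' j) + 3 := by
      intro j hj
      have hjR := hsub j hj
      have h0 := h_card j hjR
      have hj_fib : j ∈ {i ∈ R' | c i = c j} := mem_filter.2 ⟨hj, rfl⟩
      have hleaf : ∀ x ∈ A j, x ≠ v + l i - l j → (fin → x ≠ v + W (c i) - l j) →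
          x + l j ∉ P' := by
        intro x hx h1 h2 h
        rcases mem_insert.1 h with h | h
        · exact h1 (by linarith)
        · split_ifs at h with hf
          · rcases mem_insert.1 h with h | h
            · exact h2 hf (by linarith)
            · exact h_leaf j hjR x hx h
          · exact h_leaf j hjR x hx h
      have hother : c j ≠ c i → ∀ x ∈ A j, x ≠ v → x ≠ v + l i - l j →
          (fin → x ≠ v + W (c i) - l j) →
          ({i ∈ R | c i = c j} = {j} → x ≠ v + l i - W (c j)) →
          ({i ∈ R | c i = c j} = {j} → fin → x ≠ v + W (c i) - W (c j)) → x ∈ A' j := by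
        intro hc x hx h1 h2 h3 h4 h5
        refine mem_filter.2 ⟨hx, h1, hleaf x hx h2 h3, fun hone h => ?_, fun i' hi' hf => ?_⟩
        · rw [hfib j hc] at hone
          rw [hW' _ hc] at h
          rcases mem_insert.1 h with h | h
          · exact h4 hone (by linarith)
          · split_ifs at h with hf
            · rcases mem_insert.1 h with h | h
              · exact h5 hone hf (by linarith)
              · exact h_center j hjR hone x hx h
            · exact h_center j hjR hone x hx h
        · rw [hfib j hc] at hf
          rw [hW' _ hc]
          exact h_two j hjR i' hi' hf x hx
      by_cases hf : fin
      · -- Two sums are completed, and there is one star fewer.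
        have hc := hf j hj
        have hP' : #P' ≤ #P + 2 := by
          simp only [P', if_pos hf]
          exact (card_insert_le _ _).trans (Nat.succ_le_succ (card_insert_le _ _))
        have himg := himage_card hf
        rw [hfib j hc] at hj_fib ⊢
        by_cases hone : {i ∈ R | c i = c j} = {j}
        · have h := hstep j hj {v + W (c i) - l j, v + l i - W (c j), v + W (c i) - W (c j)}
            fun x hx h1 h2 h3 => by
              simp only [mem_insert, mem_singleton, not_or] at h3
              exact hother hc x hx h1 h2 (fun _ => h3.1) (fun _ => h3.2.1) fun _ _ => h3.2.2
          have h3 := card_le_three (a := v + W (c i) - l j) (b := v + l i - W (c j))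
            (c := v + W (c i) - W (c j))
          simp only [hone, card_singleton] at h0 ⊢
          norm_num at h0 ⊢
          omega
        · have h := hstep j hj {v + W (c i) - l j} fun x hx h1 h2 h3 =>
            hother hc x hx h1 h2 (fun _ => by simpa using h3) (fun h => absurd h hone)
              fun h => absurd h hone
          have hone' : #{i ∈ R | c i = c j} ≠ 1 := fun h => by
            obtain ⟨a, ha⟩ := card_eq_one.1 h
            rw [ha, mem_singleton] at hj_fib
            exact hone (by rw [ha, hj_fib])
          rw [if_neg hone'] at h0 ⊢
          rw [card_singleton] at h
          omega
      · have hP' : #P' ≤ #P + 1 := by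
          simp only [P', if_neg hf]
          exact card_insert_le _ _
        have himg := himage' hf
        rw [himg] at h0
        by_cases hc : c j = c i
        · -- The edge `j` lies in the star of `i`.
          have hfc : #{i ∈ R | c i = c j} = #{i ∈ R' | c i = c j} + 1 := by
            rw [hfib_i j hc, card_insert_of_notMem (hi_notMem _)]
          have hpos : 0 < #{i ∈ R' | c i = c j} := card_pos.2 ⟨j, hj_fib⟩
          rw [if_neg (by omega)] at h0
          by_cases hone : #{i ∈ R' | c i = c j} = 1
          · have hone' : {i ∈ R' | c i = c j} = {j} := by
              obtain ⟨a, ha⟩ := card_eq_one.1 hone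
              rw [ha, mem_singleton] at hj_fib
              rw [ha, hj_fib]
            have h := hstep j hj (P'.image (· - W' (c j))) fun x hx h1 h2 h3 => by
              refine mem_filter.2 ⟨hx, h1, hleaf x hx h2 fun h => absurd h hf, fun _ h => ?_,
                fun i' hi' h => ?_⟩
              · exact h3 (mem_image.2 ⟨_, h, by ring⟩)
              · rw [h, card_pair hi'] at hone
                omega
            -- The edge `j` has become the last of its star: its label now has to keep the sum at
            -- the centre away from all of `P'`.
            have h2 : #(P'.image (· - W' (c j))) ≤ #P' := card_image_le
            rw [if_pos hone, if_neg (by omega)]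
            omega
          · rw [if_neg hone]
            by_cases htwo : #{i ∈ R' | c i = c j} = 2
            · obtain ⟨i', hi', hfi'⟩ : ∃ i', i' ≠ j ∧ {i ∈ R' | c i = c j} = {i', j} := by
                obtain ⟨a, b, hab, h⟩ := card_eq_two.1 htwo
                rw [h, mem_insert, mem_singleton] at hj_fib
                rcases hj_fib with rfl | rfl
                · exact ⟨b, hab.symm, h.trans (pair_comm _ _)⟩
                · exact ⟨a, hab, h⟩
              have h := hstep j hj {l i' - W' (c j)} fun x hx h1 h2 h3 => by
                refine mem_filter.2 ⟨hx, h1, hleaf x hx h2 fun h => absurd h hf, fun h => ?_,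
                  fun i'' hi'' h => ?_⟩
                · rw [h, card_singleton] at htwo
                  omega
                · have hmem : i' ∈ ({i'', j} : Finset ι) := by
                    rw [← h, hfi']; exact mem_insert_self _ _
                  rw [mem_insert, mem_singleton, or_iff_left hi'] at hmem
                  subst hmem
                  intro h4
                  exact h3 (mem_singleton.2 (by linarith))
              rw [card_singleton] at h
              rw [if_pos (by omega)] at h0
              rw [if_neg (by omega)]
              omega
            · have h := hstep j hj ∅ fun x hx h1 h2 h3 => by
                refine mem_filter.2 ⟨hx, h1, hleaf x hx h2 fun h => absurd h hf, fun h => ?_,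
                  fun i'' hi'' h => ?_⟩
                · rw [h, card_singleton] at hone
                  omega
                · rw [h, card_pair hi''] at htwo
                  omega
              rw [card_empty] at h
              rw [if_pos (by omega)] at h0
              rw [if_pos (by omega)]
              omega
        · rw [hfib j hc] at hj_fib ⊢
          by_cases hone : {i ∈ R | c i = c j} = {j}
          · have h := hstep j hj {v + l i - W (c j)} fun x hx h1 h2 h3 =>
              hother hc x hx h1 h2 (fun h => absurd h hf) (fun _ => by simpa using h3)
                fun _ h => absurd h hf
            rw [card_singleton] at h
            simp only [hone, card_singleton] at h0 ⊢
            norm_num at h0 ⊢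
            omega
          · have h := hstep j hj ∅ fun x hx h1 h2 h3 =>
              hother hc x hx h1 h2 (fun h => absurd h hf) (fun h => absurd h hone)
                fun h => absurd h hone
            have hone' : #{i ∈ R | c i = c j} ≠ 1 := fun h => by
              obtain ⟨a, ha⟩ := card_eq_one.1 h
              rw [ha, mem_singleton] at hj_fib
              exact hone (by rw [ha, hj_fib])
            rw [if_neg hone'] at h0 ⊢
            rw [card_empty] at h
            omega
    obtain ⟨x, hxA, hgood, hxP⟩ := ih R' W' P' A' (fun j hj x hx => (mem_filter.1 hx).2.2.1)
      (fun j hj hj' x hx => (mem_filter.1 hx).2.2.2.1 hj')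
      (fun j hj hj' => by
        by_cases hc : c j = c i
        · -- The edges `i` and `j` were the last two of their star.
          left
          have hij : i ≠ j := fun h => by simp [R', h] at hj
          have h := h_two i hi j hij.symm (by
            rw [← hc, hfib_i j hc, hj', pair_comm]) v hv
          rw [hc, hW'i]
          exact h.symm
        · rw [hW' _ hc]
          exact h_last j (hsub j hj) (by rw [← hfib j hc]; exact hj'))
      (fun j hj i' hi' hf x hx => (mem_filter.1 hx).2.2.2.2 i' hi' hf)
      hcard' (by omega)
    have hup : ∀ j ∈ R', Function.update x i v j = x j := fun j hj => by
      simp [ne_of_mem_erase hj]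
    have hxi : Function.update x i v i = v := Function.update_self ..
    have cases : ∀ j ∈ R, j = i ∨ j ∈ R' := fun j hj => by
      rw [mem_erase]; tauto
    -- The sums at the centres, written in terms of the labels chosen later.
    have hsum : ∀ k, W k + ∑ j ∈ R with c j = k, Function.update x i v j =
        W' k + ∑ j ∈ R' with c j = k, x j := by
      intro k
      have h1 : ∑ j ∈ R' with c j = k, Function.update x i v j = ∑ j ∈ R' with c j = k, x j :=
        sum_congr rfl fun j hj => hup j (mem_filter.1 hj).1
      by_cases hk : k = c i
      · subst hk
        rw [hfib_i i rfl, sum_insert (hi_notMem _), h1, hxi, hW'i, add_assoc]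
      · rw [hW' k hk, ← h1]
        congr 2
        ext j
        simp only [mem_filter, R', mem_erase]
        constructor
        · rintro ⟨h1, h2⟩
          exact ⟨⟨by rintro rfl; exact hk h2.symm, h1⟩, h2⟩
        · tauto
    have hsum_fin : fin → W' (c i) + ∑ j ∈ R' with c j = c i, x j = v + W (c i) := fun h => by
      rw [filter_eq_empty_iff.2 fun j hj => h j hj, sum_empty, hW'i]
      ring
    have hfin : ∀ k ∈ R.image c, k ∈ R'.image c ∨ fin ∧ k = c i := by
      intro k hk
      by_cases h : fin
      · rw [himage h, mem_insert] at hk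
        tauto
      · rw [himage' h] at hk
        exact Or.inl hk
    have hxA' : ∀ j ∈ R', x j ∈ A j ∧ x j ≠ v ∧ x j + l j ∉ P' := fun j hj => by
      have := mem_filter.1 (hxA j hj)
      exact ⟨this.1, this.2.1, this.2.2.1⟩
    refine ⟨Function.update x i v, ?_, ⟨?_, ?_, ?_, ?_⟩, ?_⟩
    · intro j hj
      rcases cases j hj with rfl | hj'
      · rw [hxi]; exact hv
      · rw [hup j hj']; exact (hxA' j hj').1
    · intro j₁ h₁ j₂ h₂ heq
      rcases cases j₁ h₁ with rfl | h₁' <;> rcases cases j₂ h₂ with rfl | h₂'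
      · rfl
      · rw [hup j₂ h₂', hxi] at heq
        exact absurd heq.symm (hxA' _ h₂').2.1
      · rw [hup j₁ h₁', hxi] at heq
        exact absurd heq (hxA' _ h₁').2.1
      · rw [hup j₁ h₁', hup j₂ h₂'] at heq
        exact hgood.label_injOn h₁' h₂' heq
    · intro j₁ h₁ j₂ h₂ heq
      simp only at heq
      rcases cases j₁ h₁ with rfl | h₁' <;> rcases cases j₂ h₂ with rfl | h₂'
      · rfl
      · rw [hup j₂ h₂', hxi] at heq
        exact absurd (heq ▸ hiP) (hxA' _ h₂').2.2
      · rw [hup j₁ h₁', hxi] at heq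
        exact absurd (heq ▸ hiP) (hxA' _ h₁').2.2
      · rw [hup j₁ h₁', hup j₂ h₂'] at heq
        exact hgood.leaf_injOn h₁' h₂' heq
    · intro k₁ h₁ k₂ h₂ heq
      simp only [hsum] at heq
      rcases hfin k₁ h₁ with h₁' | ⟨hf, rfl⟩ <;> rcases hfin k₂ h₂ with h₂' | ⟨hf', rfl⟩
      · exact hgood.center_injOn h₁' h₂' heq
      · rw [hsum_fin hf'] at heq
        exact absurd (heq ▸ hiP_center hf') (hxP _ h₁')
      · rw [hsum_fin hf] at heq
        exact absurd (heq ▸ hiP_center hf) (hxP _ h₂')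
      · rfl
    · intro j hj k hk heq
      rw [hsum] at heq
      rcases cases j hj with rfl | hj' <;> rcases hfin k hk with hk' | ⟨hf, rfl⟩
      · rw [hxi] at heq
        exact absurd (heq ▸ hiP) (hxP _ hk')
      · rw [hxi, hsum_fin hf] at heq
        refine ⟨rfl, (h_last j hj ?_).resolve_left fun h => h (by linarith)⟩
        rw [hfib_i j rfl, filter_eq_empty_iff.2 fun j hj => hf j hj]
        rfl
      · rw [hup j hj'] at heq
        exact hgood.leaf_center j hj' k hk' heq
      · rw [hup j hj', hsum_fin hf] at heq
        exact absurd (heq ▸ hiP_center hf) (hxA' j hj').2.2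
    · intro k hk
      rw [hsum]
      rcases hfin k hk with hk' | ⟨hf, rfl⟩
      · exact fun h => hxP k hk' (hP h)
      · rw [hsum_fin hf, add_comm]
        have h := h_center i hi (by
          rw [hfib_i i rfl, filter_eq_empty_iff.2 fun j hj => hf j hj]
          rfl) v hv
        rwa [add_comm] at h

end StarForest

namespace StarForest

open Finset

/-! ### Forests of many stars -/

/-- One edge `m k` of each star `k` is set aside. The other edges `U` are labelled greedily, which
makes the sums at their leaves final; the edges set aside then behave like single edges and are
labelled by `exists_good_matching`, after each label and each leaf sum of `U` has been avoided. -/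
theorem exists_good_of_many_stars {ι κ : Type*} [DecidableEq ι] [DecidableEq κ] (c : ι → κ)
    (l : ι → ℝ) (Ex : κ → Prop) (R : Finset ι) (W : κ → ℝ) (A : ι → Finset ℝ) (K : ℕ)
    (h_last : ∀ j ∈ R, {i ∈ R | c i = c j} = {j} → l j ≠ W (c j) ∨ Ex (c j))
    (hK : 2 * #R ≤ K + 2) (hp : #R ≤ 2 * #(R.image c)) (hA : ∀ j ∈ R, #R + K ≤ #(A j)) :
    ∃ x : ι → ℝ, (∀ j ∈ R, x j ∈ A j) ∧ IsGood R c l W Ex x := by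
  classical
  rcases R.eq_empty_or_nonempty with rfl | ⟨j₀, hj₀⟩
  · exact ⟨fun _ => 0, by simp, ⟨by simp, by simp, by simp, by simp⟩⟩
  have : Nonempty ι := ⟨j₀⟩
  have hm : ∀ k, ∃ j, k ∈ R.image c → j ∈ R ∧ c j = k := fun k => by
    by_cases h : k ∈ R.image c
    · obtain ⟨j, hj⟩ := mem_image.1 h
      exact ⟨j, fun _ => hj⟩
    · exact ⟨j₀, fun h' => absurd h' h⟩
  -- The edge `m k` is the one set aside in the star `k`.
  choose m hm using hm
  have hmem : ∀ {j}, j ∈ R → c j ∈ R.image c := fun hj => mem_image_of_mem c hj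
  let U : Finset ι := {j ∈ R | m (c j) ≠ j}
  let M : Finset ι := {j ∈ R | m (c j) = j}
  have hUR : ∀ j ∈ U, j ∈ R := fun j hj => (mem_filter.1 hj).1
  have hMR : ∀ j ∈ M, j ∈ R := fun j hj => (mem_filter.1 hj).1
  have hMm : ∀ j ∈ M, m (c j) = j := fun j hj => (mem_filter.1 hj).2
  have hmM : ∀ k ∈ R.image c, m k ∈ M := fun k hk =>
    mem_filter.2 ⟨(hm k hk).1, by rw [(hm k hk).2]⟩
  have cases : ∀ j ∈ R, j ∈ U ∨ j ∈ M := fun j hj => by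
    simp only [U, M, mem_filter]; tauto
  have hMU : ∀ j ∈ M, j ∉ U := fun j hj h => (mem_filter.1 h).2 (hMm j hj)
  have hMcard : #M = #(R.image c) := by
    refine card_bij (fun j _ => c j) (fun j hj => hmem (hMR j hj)) (fun j hj j' hj' h => ?_)
      fun k hk => ⟨m k, hmM k hk, (hm k hk).2⟩
    rw [← hMm j hj, ← hMm j' hj', h]
  have hcard : #M + #U = #R := card_filter_add_card_filter_not (s := R) (fun j => m (c j) = j)
  have hpos : 0 < #(R.image c) := card_pos.2 ⟨_, hmem hj₀⟩
  -- In a star with several edges, the two sums at the ends of the edge set aside contain the same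
  -- label of that edge; they are kept apart by the labels of the other edges of the star.
  obtain ⟨u, huA, hu1, hu2⟩ := exists_greedy A {0, l} (R.image c)
    (fun k e => if c e = k then 1 else 0) (fun k => W k - l (m k)) U (by
      intro e he
      have h0 := hA e (hUR e he)
      have h1 : #({0, l} : Finset (ι → ℝ)) ≤ 2 := card_le_two
      have h2 : #{k ∈ R.image c | (if c e = k then (1 : ℝ) else 0) ≠ 0} ≤ 1 := by
        rw [card_le_one]
        intro k hk k' hk'
        simp only [mem_filter, ne_eq, ite_eq_right_iff, one_ne_zero, imp_false, not_not] at hk hk'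
        rw [← hk.2, hk'.2]
      have h3 : 0 < #U := card_pos.2 ⟨e, he⟩
      have h4 := Nat.mul_le_mul_right #U h1
      omega)
  have hu_inj : Set.InjOn u U := by simpa using hu1 0 (by simp)
  have hul_inj : Set.InjOn (fun j => u j + l j) U := hu1 l (by simp)
  -- The sum at the centre of the star of `j`, without the label of the edge set aside.
  let z : ι → ℝ := fun j => W (c j) + ∑ e ∈ U with c e = c j, u e
  have hfib : ∀ k ∈ R.image c, {j ∈ R | c j = k} = insert (m k) {j ∈ U | c j = k} := by
    intro k hk
    ext j
    simp only [mem_filter, mem_insert, U]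
    constructor
    · rintro ⟨h1, rfl⟩
      by_cases h : m (c j) = j
      · exact Or.inl h.symm
      · exact Or.inr ⟨⟨h1, h⟩, rfl⟩
    · rintro (rfl | h)
      · exact hm k hk
      · exact ⟨h.1.1, h.2⟩
  obtain ⟨y, hyA, hy1, hy2, hy3, hy4⟩ := exists_good_matching l z (fun j => Ex (c j)) M
    (fun j => ((A j \ U.image u) \ U.image (fun e => u e + l e - l j)) \
      U.image (fun e => u e + l e - z j))
    (by
      intro j hj
      by_cases hex : ∃ e ∈ U, c e = c j
      · left
        obtain ⟨e, he, hec⟩ := hex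
        have h := hu2 (c j) (hmem (hMR j hj)) ⟨e, he, by simp [hec]⟩
        simp only [ite_mul, one_mul, zero_mul, ← sum_filter, hMm j hj] at h
        intro heq
        apply h
        simp only [z] at heq
        linarith
      · have hempty : {e ∈ U | c e = c j} = ∅ := filter_eq_empty_iff.2 fun e he h => hex ⟨e, he, h⟩
        simp only [z, hempty, sum_empty, add_zero]
        refine h_last j (hMR j hj) ?_
        rw [hfib _ (hmem (hMR j hj)), hempty, hMm j hj]
        rfl)
    (by
      intro j hj
      have h0 := hA j (hMR j hj)
      have h1 := le_card_sdiff (U.image u) (A j)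
      have h2 := le_card_sdiff (U.image (fun e => u e + l e - l j)) (A j \ U.image u)
      have h3 := le_card_sdiff (U.image (fun e => u e + l e - z j))
        ((A j \ U.image u) \ U.image (fun e => u e + l e - l j))
      have h1' : #(U.image u) ≤ #U := card_image_le
      have h2' : #(U.image (fun e => u e + l e - l j)) ≤ #U := card_image_le
      have h3' : #(U.image (fun e => u e + l e - z j)) ≤ #U := card_image_le
      omega)
  have hy : ∀ j ∈ M, y j ∈ A j ∧ (∀ e ∈ U, u e ≠ y j) ∧ (∀ e ∈ U, u e + l e ≠ y j + l j) ∧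
      ∀ e ∈ U, u e + l e ≠ y j + z j := by
    intro j hj
    have := hyA j hj
    simp only [mem_sdiff, mem_image, not_exists, not_and] at this
    exact ⟨this.1.1.1, this.1.1.2, fun e he h => this.1.2 e he (by linarith),
      fun e he h => this.2 e he (by linarith)⟩
  let x : ι → ℝ := fun j => if j ∈ U then u j else y j
  have hxU : ∀ j ∈ U, x j = u j := fun j hj => if_pos hj
  have hxM : ∀ j ∈ M, x j = y j := fun j hj => if_neg (hMU j hj)
  have hsum : ∀ k ∈ R.image c, W k + ∑ j ∈ R with c j = k, x j = y (m k) + z (m k) := by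
    intro k hk
    have h1 : ∑ j ∈ U with c j = k, x j = ∑ j ∈ U with c j = k, u j :=
      sum_congr rfl fun j hj => hxU j (mem_filter.1 hj).1
    rw [hfib k hk, sum_insert fun h => hMU _ (hmM k hk) (mem_filter.1 h).1, h1, hxM _ (hmM k hk)]
    simp only [z, (hm k hk).2]
    ring
  have inj : ∀ s : ι → ℝ, Set.InjOn (fun j => u j + s j) U → Set.InjOn (fun j => y j + s j) M →
      (∀ j ∈ M, ∀ e ∈ U, u e + s e ≠ y j + s j) → Set.InjOn (fun j => x j + s j) R := by
    intro s hs₁ hs₂ hne j₁ h₁ j₂ h₂ heq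
    simp only at heq
    rcases cases j₁ h₁ with h₁' | h₁' <;> rcases cases j₂ h₂ with h₂' | h₂'
    · rw [hxU _ h₁', hxU _ h₂'] at heq
      exact hs₁ h₁' h₂' heq
    · rw [hxU _ h₁', hxM _ h₂'] at heq
      exact absurd heq (hne _ h₂' _ h₁')
    · rw [hxM _ h₁', hxU _ h₂'] at heq
      exact absurd heq.symm (hne _ h₁' _ h₂')
    · rw [hxM _ h₁', hxM _ h₂'] at heq
      exact hs₂ h₁' h₂' heq
  refine ⟨x, fun j hj => ?_, ⟨?_, inj l hul_inj hy2 fun j hj => (hy j hj).2.2.1, ?_, ?_⟩⟩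
  · rcases cases j hj with h | h
    · rw [hxU j h]; exact huA j h
    · rw [hxM j h]; exact (hy j h).1
  · simpa using inj 0 (by simpa using hu_inj) (by simpa using hy1)
      fun j hj => by simpa using (hy j hj).2.1
  · intro k₁ h₁ k₂ h₂ heq
    simp only at heq
    rw [hsum k₁ h₁, hsum k₂ h₂] at heq
    have := hy3 (mem_coe.2 (hmM k₁ h₁)) (mem_coe.2 (hmM k₂ h₂)) heq
    rw [← (hm k₁ h₁).2, ← (hm k₂ h₂).2, this]
  · intro j hj k hk heq
    rw [hsum k hk] at heq
    rcases cases j hj with h | h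
    · rw [hxU j h] at heq
      exact absurd heq ((hy _ (hmM k hk)).2.2.2 j h)
    · rw [hxM j h] at heq
      have := hy4 j h _ (hmM k hk) heq
      rw [(hm k hk).2] at this
      exact ⟨by rw [this.1, (hm k hk).2], this.2⟩

/-- A star forest on `N` vertices whose lists have at least `K ≥ ⌊4N/3⌋` more labels than the forest
has edges has a good labelling. The bound on `K` is `hK`, written without division. If at least a
third of the vertices are centres, `exists_good_of_many_stars` applies, and otherwise
`exists_good_of_admissible`. -/
theorem exists_good {ι κ : Type*} [DecidableEq ι] [DecidableEq κ] (c : ι → κ)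
    (l : ι → ℝ) (Ex : κ → Prop) (R : Finset ι) (W : κ → ℝ) (A : ι → Finset ℝ) (K : ℕ)
    (h_last : ∀ j ∈ R, {i ∈ R | c i = c j} = {j} → l j ≠ W (c j) ∨ Ex (c j))
    (hK : 4 * (#R + #(R.image c)) ≤ 3 * K + 2) (hA : ∀ j ∈ R, #R + K ≤ #(A j)) :
    ∃ x : ι → ℝ, (∀ j ∈ R, x j ∈ A j) ∧ IsGood R c l W Ex x := by
  classical
  by_cases hp : #R ≤ 2 * #(R.image c)
  · exact exists_good_of_many_stars c l Ex R W A K h_last (by omega) hp hA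
  -- In stars with exactly two edges, at most one label has to be excluded from each list.
  let A' : ι → Finset ℝ := fun j =>
    {x ∈ A j | ∀ i, i ≠ j → {i ∈ R | c i = c j} = {i, j} → W (c j) + x ≠ l i}
  obtain ⟨x, hxA, hx, -⟩ := exists_good_of_admissible c l Ex R W ∅ A' (by simp) (by simp) h_last
    (fun j hj i hij hf x hx => (mem_filter.1 hx).2 i hij hf) (by
      intro j hj
      have h0 := hA j hj
      have hlarge : ∀ i, i ≠ j → {i ∈ R | c i = c j} = {i, j} → #{i ∈ R | c i = c j} = 2 :=
        fun i hij h => by rw [h, card_pair hij]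
      by_cases htwo : ∃ i, i ≠ j ∧ {i ∈ R | c i = c j} = {i, j}
      · obtain ⟨i, hij, hf⟩ := htwo
        have h1 : #(A j \ {l i - W (c j)}) ≤ #(A' j) := by
          refine card_le_card fun x hx => ?_
          rw [mem_sdiff, mem_singleton] at hx
          refine mem_filter.2 ⟨hx.1, fun i' hi' hf' h => ?_⟩
          have hmem : i' ∈ ({i, j} : Finset ι) := by
            rw [← hf, hf']; exact mem_insert_self _ _
          rw [mem_insert, mem_singleton, or_iff_left hi'] at hmem
          subst hmem
          exact hx.2 (by linarith)
        have h2 := le_card_sdiff {l i - W (c j)} (A j)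
        rw [card_singleton] at h2
        rw [hlarge i hij hf]
        norm_num
        omega
      · have h1 : A' j = A j := filter_true_of_mem fun x _ i hij hf =>
          absurd ⟨i, hij, hf⟩ htwo
        rw [h1, card_empty, ite_self]
        split_ifs <;> omega)
  exact ⟨x, fun j hj => (mem_filter.1 (hxA j hj)).1, hx⟩

end StarForest

namespace SimpleGraph

open Finset

/-! ### Complete components -/

/-- A clique that no edge leaves is a complete component. -/
theorem isCompleteComponent_card_of_isClique {V : Type*} {G : SimpleGraph V} {s : Finset V} {v : V}
    (hv : v ∈ s) (hclosed : ∀ a ∈ s, ∀ b, G.Adj a b → b ∈ s) (hs : G.IsClique (s : Set V)) :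
    (G.connectedComponentMk v).IsCompleteComponent #s := by
  have hwalk : ∀ {a b : V}, G.Walk a b → a ∈ s → b ∈ s := by
    intro a b p
    induction p with
    | nil => exact id
    | cons h _ ih => exact fun ha => ih (hclosed _ ha _ h)
  have hmem : ∀ w, w ∈ G.connectedComponentMk v ↔ w ∈ s := by
    intro w
    change G.connectedComponentMk w = G.connectedComponentMk v ↔ w ∈ s
    rw [ConnectedComponent.eq]
    constructor
    · rintro ⟨p⟩
      exact hwalk p.reverse hv
    · intro hw
      by_cases h : w = v
      · rw [h]
      · exact (hs hw hv h).reachable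
  let φ : (G.connectedComponentMk v) ≃ Fin #s :=
    (Equiv.subtypeEquivRight hmem).trans s.equivFin
  refine ⟨⟨φ, ?_⟩⟩
  rintro ⟨a, ha⟩ ⟨b, hb⟩
  rw [top_adj, φ.injective.ne_iff, ConnectedComponent.toSimpleGraph_adj, ne_eq, Subtype.mk.injEq]
  exact ⟨hs ((hmem a).1 ha) ((hmem b).1 hb), fun h => h.ne⟩

theorem IsIsolated.isCompleteComponent {V : Type*} {G : SimpleGraph V} {v : V}
    (h : G.IsIsolated v) : (G.connectedComponentMk v).IsCompleteComponent 1 := by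
  have := isCompleteComponent_card_of_isClique (G := G) (s := {v}) (mem_singleton_self v)
    (fun a ha b hab => by rw [mem_singleton.1 ha] at hab; exact absurd hab (h b)) (by simp)
  rwa [card_singleton] at this

theorem Adj.isCompleteComponent {V : Type*} {G : SimpleGraph V} {u v : V} (h : G.Adj u v)
    (hu : ∀ w, G.Adj u w → w = v) (hv : ∀ w, G.Adj v w → w = u) :
    (G.connectedComponentMk v).IsCompleteComponent 2 := by
  classical
  have := isCompleteComponent_card_of_isClique (G := G) (s := {u, v}) (v := v) (by simp)
    (fun a ha b hab => by
      rcases mem_insert.1 ha with rfl | ha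
      · simp [hu b hab]
      · rw [mem_singleton.1 ha] at hab
        simp [hv b hab]) (by simp [h])
  rwa [card_pair h.ne] at this

/-! ### Spanning star forests -/

/-- The edges `T` form a star forest covering all non-isolated vertices: the edge `e ∈ T` joins the
vertex `leaf e`, which is on no other edge of `T`, to the centre `center e` of its star. -/
structure IsStarCover {V : Type*} (G : SimpleGraph V) (T : Finset G.edgeSet)
    (leaf center : G.edgeSet → V) : Prop where
  edge_eq : ∀ e ∈ T, (e : Sym2 V) = s(leaf e, center e)
  eq_of_leaf_mem : ∀ e ∈ T, ∀ e' ∈ T, leaf e ∈ (e' : Sym2 V) → e' = e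
  exists_mem : ∀ v, ¬ G.IsIsolated v → ∃ e ∈ T, v ∈ (e : Sym2 V)

/-- A minimal edge cover is a star forest: by minimality, each of its edges has an end that is on no
other edge of the cover. -/
theorem exists_isStarCover {V : Type*} [Finite V] (G : SimpleGraph V) :
    ∃ (T : Finset G.edgeSet) (leaf center : G.edgeSet → V), G.IsStarCover T leaf center := by
  classical
  have := Fintype.ofFinite V
  obtain ⟨T, hT⟩ := exists_minimal_of_wellFoundedLT
    (fun T : Finset G.edgeSet => ∀ v, ¬ G.IsIsolated v → ∃ e ∈ T, v ∈ (e : Sym2 V))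
    ⟨univ, fun v hv => by
      obtain ⟨w, hw⟩ := exists_adj_iff_not_isIsolated.2 hv
      exact ⟨⟨s(v, w), hw⟩, mem_univ _, Sym2.mem_mk_left v w⟩⟩
  have hends : ∀ e : G.edgeSet, ∃ p : V × V, e ∈ T →
      (e : Sym2 V) = s(p.1, p.2) ∧ ∀ e' ∈ T, p.1 ∈ (e' : Sym2 V) → e' = e := by
    intro e
    by_cases he : e ∈ T
    · have h := hT.not_prop_of_lt (erase_ssubset he)
      push Not at h
      obtain ⟨v, hv, hve⟩ := h
      have huniq : ∀ e' ∈ T, v ∈ (e' : Sym2 V) → e' = e := fun e' he' hve' => by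
        by_contra hne
        exact hve e' (mem_erase.2 ⟨hne, he'⟩) hve'
      obtain ⟨e', he', hve'⟩ := hT.prop v hv
      obtain rfl := huniq e' he' hve'
      obtain ⟨w, hw⟩ := hve'
      exact ⟨(v, w), fun _ => ⟨hw, huniq⟩⟩
    · exact ⟨(e : Sym2 V).out, fun h => absurd h he⟩
  choose p hp using hends
  exact ⟨T, fun e => (p e).1, fun e => (p e).2, fun e he => (hp e he).1,
    fun e he => (hp e he).2, hT.prop⟩

namespace IsStarCover

variable {V : Type*} {G : SimpleGraph V} {T : Finset G.edgeSet} {leaf center : G.edgeSet → V}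

theorem adj (h : G.IsStarCover T leaf center) {e : G.edgeSet} (he : e ∈ T) :
    G.Adj (leaf e) (center e) := by
  rw [← mem_edgeSet, ← h.edge_eq e he]
  exact e.2

theorem leaf_mem (h : G.IsStarCover T leaf center) {e : G.edgeSet} (he : e ∈ T) :
    leaf e ∈ (e : Sym2 V) := by
  rw [h.edge_eq e he]; exact Sym2.mem_mk_left _ _

theorem center_mem (h : G.IsStarCover T leaf center) {e : G.edgeSet} (he : e ∈ T) :
    center e ∈ (e : Sym2 V) := by
  rw [h.edge_eq e he]; exact Sym2.mem_mk_right _ _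

theorem mem_iff (h : G.IsStarCover T leaf center) {e : G.edgeSet} (he : e ∈ T) {v : V} :
    v ∈ (e : Sym2 V) ↔ v = leaf e ∨ v = center e := by
  rw [h.edge_eq e he, Sym2.mem_iff]

theorem leaf_mem_iff (h : G.IsStarCover T leaf center) {e e' : G.edgeSet} (he : e ∈ T)
    (he' : e' ∈ T) : leaf e ∈ (e' : Sym2 V) ↔ e' = e :=
  ⟨h.eq_of_leaf_mem e he e' he', fun h' => by rw [h']; exact h.leaf_mem he⟩

theorem center_ne_leaf (h : G.IsStarCover T leaf center) {e e' : G.edgeSet} (he : e ∈ T)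
    (he' : e' ∈ T) : center e ≠ leaf e' := by
  intro heq
  have := h.eq_of_leaf_mem e' he' e he (heq ▸ h.center_mem he)
  subst this
  exact (h.adj he).ne heq.symm

theorem center_mem_iff (h : G.IsStarCover T leaf center) {e e' : G.edgeSet} (he : e ∈ T)
    (he' : e' ∈ T) : center e ∈ (e' : Sym2 V) ↔ center e' = center e := by
  rw [h.mem_iff he', or_iff_right (h.center_ne_leaf he he'), eq_comm]

theorem card_add_card_le [Fintype V] [DecidableEq V] (h : G.IsStarCover T leaf center) :
    #T + #(T.image center) ≤ Fintype.card V := by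
  have hinj : Set.InjOn leaf T := fun e he e' he' heq =>
    h.eq_of_leaf_mem e' he' e he (heq ▸ h.leaf_mem he)
  have hdisj : Disjoint (T.image leaf) (T.image center) := by
    rw [Finset.disjoint_left]
    intro v h₁ h₂
    obtain ⟨e, he, rfl⟩ := mem_image.1 h₁
    obtain ⟨e', he', heq⟩ := mem_image.1 h₂
    exact h.center_ne_leaf he' he heq
  rw [← card_image_of_injOn hinj, ← card_union_of_disjoint hdisj]
  exact card_le_univ _

/-- If the star of `e` is a single edge and no edge outside `T` meets `e`, then `e` spans a
component. -/
theorem isCompleteComponent (h : G.IsStarCover T leaf center) {e : G.edgeSet} (he : e ∈ T)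
    (hsingle : ∀ e' ∈ T, center e' = center e → e' = e)
    (hout : ∀ e' ∉ T, leaf e ∉ (e' : Sym2 V) ∧ center e ∉ (e' : Sym2 V)) :
    (G.connectedComponentMk (center e)).IsCompleteComponent 2 := by
  refine (h.adj he).isCompleteComponent (fun w hw => ?_) fun w hw => ?_
  · let e' : G.edgeSet := ⟨s(leaf e, w), hw⟩
    have hmem : leaf e ∈ (e' : Sym2 V) := Sym2.mem_mk_left _ _
    have he' : e' ∈ T := by_contra fun h' => (hout e' h').1 hmem
    have heq : (e' : Sym2 V) = e := congrArg _ (h.eq_of_leaf_mem e he e' he' hmem)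
    rw [h.edge_eq e he] at heq
    exact Sym2.congr_right.1 heq
  · let e' : G.edgeSet := ⟨s(center e, w), hw⟩
    have hmem : center e ∈ (e' : Sym2 V) := Sym2.mem_mk_left _ _
    have he' : e' ∈ T := by_contra fun h' => (hout e' h').2 hmem
    have heq : (e' : Sym2 V) = e :=
      congrArg _ (hsingle e' he' ((h.center_mem_iff he he').1 hmem))
    rw [h.edge_eq e he, Sym2.eq_swap] at heq
    exact Sym2.congr_right.1 heq

end IsStarCover

end SimpleGraph

namespace SimpleGraph

open Finset StarForest

/-! ### Labelling a graph along a spanning star forest -/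

namespace IsStarCover

variable {V : Type*} {G : SimpleGraph V} {T : Finset G.edgeSet} {leaf center : G.edgeSet → V}

/-- Two distinct single-edge stars are disjoint, so an edge of the graph meets at most two. -/
theorem card_filter_meets_le (h : G.IsStarCover T leaf center) [DecidableEq V]
    {Q : Finset G.edgeSet} (hQT : Q ⊆ T)
    (hQ : ∀ q ∈ Q, ∀ e ∈ T, center e = center q → e = q) (e : G.edgeSet)
    [DecidablePred fun q : G.edgeSet => leaf q ∈ (e : Sym2 V) ∨ center q ∈ (e : Sym2 V)] :
    #{q ∈ Q | leaf q ∈ (e : Sym2 V) ∨ center q ∈ (e : Sym2 V)} ≤ 2 := by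
  have hone : ∀ v, #{q ∈ Q | v = leaf q ∨ v = center q} ≤ 1 := by
    intro v
    rw [card_le_one]
    intro q hq q' hq'
    rw [mem_filter] at hq hq'
    obtain ⟨hq, h₁⟩ := hq
    obtain ⟨hq', h₂⟩ := hq'
    have hmem : v ∈ (q' : Sym2 V) := (h.mem_iff (hQT hq')).2 h₂
    rcases h₁ with rfl | rfl
    · exact (h.eq_of_leaf_mem q (hQT hq) q' (hQT hq') hmem).symm
    · exact (hQ q hq q' (hQT hq') ((h.center_mem_iff (hQT hq) (hQT hq')).1 hmem)).symm
  obtain ⟨e, he⟩ := e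
  induction e using Sym2.ind with
  | _ a b =>
    have hsub : {q ∈ Q | leaf q ∈ s(a, b) ∨ center q ∈ s(a, b)} ⊆
        {q ∈ Q | a = leaf q ∨ a = center q} ∪ {q ∈ Q | b = leaf q ∨ b = center q} := by
      intro q
      simp only [mem_filter, mem_union, Sym2.mem_iff]
      tauto
    have h1 := card_le_card hsub
    have h2 := card_union_le {q ∈ Q | a = leaf q ∨ a = center q}
      {q ∈ Q | b = leaf q ∨ b = center q}
    have h3 := hone a
    have h4 := hone b
    exact h1.trans (h2.trans (by omega))

/-- Labels for the edges outside `T` can be chosen so that the two partial sums at a single-edge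
star of `T` differ, unless that edge is a component of the graph. -/
theorem exists_label_outside [Fintype V] [Fintype G.edgeSet] [DecidableEq V]
    (h : G.IsStarCover T leaf center) (ω : V → ℝ) (L : G.edgeSet → Finset ℝ)
    (hL : ∀ e ∉ T, #Tᶜ + 2 < #(L e)) :
    ∃ g : G.edgeSet → ℝ, (∀ e ∉ T, g e ∈ L e) ∧ Set.InjOn g ↑Tᶜ ∧
      ∀ e ∈ T, (∀ e' ∈ T, center e' = center e → e' = e) →
        ω (leaf e) + ∑ e' ∈ Tᶜ with leaf e ∈ e'.1, g e' ≠
          ω (center e) + ∑ e' ∈ Tᶜ with center e ∈ e'.1, g e' ∨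
        (G.connectedComponentMk (center e)).IsCompleteComponent 2 := by
  classical
  let Q : Finset G.edgeSet := {e ∈ T | ∀ e' ∈ T, center e' = center e → e' = e}
  let a : G.edgeSet → G.edgeSet → ℝ := fun q e =>
    (if leaf q ∈ (e : Sym2 V) then 1 else 0) - (if center q ∈ (e : Sym2 V) then 1 else 0)
  obtain ⟨g, hgL, hg, hgQ⟩ := exists_greedy L {0} Q a (fun q => ω (leaf q) - ω (center q)) Tᶜ (by
    intro e he
    have h1 := hL e (mem_compl.1 he)
    have h2 := h.card_filter_meets_le (Q := Q) (filter_subset _ _)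
      (fun q hq => (mem_filter.1 hq).2) e
    have h3 : #{q ∈ Q | a q e ≠ 0} ≤
        #{q ∈ Q | leaf q ∈ (e : Sym2 V) ∨ center q ∈ (e : Sym2 V)} := by
      refine card_le_card (monotone_filter_right _ fun q _ hq => ?_)
      by_contra hno
      rw [not_or] at hno
      exact hq (by simp [a, hno.1, hno.2])
    rw [card_singleton, one_mul]
    omega)
  refine ⟨g, fun e he => hgL e (mem_compl.2 he), by simpa using hg, fun e he hsingle => ?_⟩
  have hout : ∀ e' ∉ T, a e e' = 0 → leaf e ∉ (e' : Sym2 V) ∧ center e ∉ (e' : Sym2 V) := by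
    intro e' he' ha
    by_cases h1 : leaf e ∈ (e' : Sym2 V) <;> by_cases h2 : center e ∈ (e' : Sym2 V)
    · have heq : e' = e := Subtype.ext (by
        rw [h.edge_eq e he]
        exact (Sym2.mem_and_mem_iff (h.adj he).ne).1 ⟨h1, h2⟩)
      exact absurd (heq ▸ he) he'
    · simp [a, h1, h2] at ha
    · simp [a, h1, h2] at ha
    · exact ⟨h1, h2⟩
  by_cases hex : ∃ e' ∈ Tᶜ, a e e' ≠ 0
  · left
    have := hgQ e (mem_filter.2 ⟨he, hsingle⟩) hex
    simp only [a, sub_mul, ite_mul, one_mul, zero_mul, sum_sub_distrib, ← sum_filter] at this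
    intro heq
    apply this
    linarith
  · right
    push Not at hex
    exact h.isCompleteComponent he hsingle fun e' he' => hout e' he' (hex e' (mem_compl.2 he'))

end IsStarCover

theorem isListWeightedQuasiAntimagic {V : Type*} [Fintype V] (G : SimpleGraph V) :
    G.IsListWeightedQuasiAntimagic (4 * Fintype.card V / 3) := by
  classical
  intro ω L hL
  set K := 4 * Fintype.card V / 3 with hK
  obtain ⟨T, leaf, center, h⟩ := G.exists_isStarCover
  have hncard : G.edgeSet.ncard = #T + #Tᶜ := by
    rw [card_add_card_compl, ← Nat.card_eq_fintype_card, Nat.card_coe_set_eq]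
  -- Replace the lists by finite lists.
  have hfin : ∀ e, ∃ A : Finset ℝ, ↑A ⊆ L e ∧ #A = #T + #Tᶜ + K := by
    intro e
    obtain ⟨A, hA, hcard⟩ := Set.exists_subset_encard_eq (hL e)
    have hAfin : A.Finite := Set.finite_of_encard_eq_coe hcard
    refine ⟨hAfin.toFinset, by simpa using hA, ?_⟩
    rw [hAfin.encard_eq_coe_toFinset_card, hncard] at hcard
    exact_mod_cast hcard
  choose A hAL hA using hfin
  have hTV := h.card_add_card_le
  obtain ⟨g, hgA, hg, hgT⟩ := h.exists_label_outside ω A (by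
    intro e _
    obtain ⟨⟨v, w⟩, hvw⟩ := e
    have hadj : G.Adj v w := hvw
    obtain ⟨e', he', -⟩ := h.exists_mem v hadj.not_isIsolated_left
    have h1 : 0 < #T := card_pos.2 ⟨e', he'⟩
    have h2 : 1 < Fintype.card V := Fintype.one_lt_card_iff.2 ⟨v, w, hadj.ne⟩
    rw [hA]
    omega)
  -- The partial sums from the weights and the edges outside `T`.
  let w : V → ℝ := fun v => ω v + ∑ e ∈ Tᶜ with v ∈ e.1, g e
  obtain ⟨x, hxA, hx⟩ := exists_good center (fun e => w (leaf e))
    (fun v => (G.connectedComponentMk v).IsCompleteComponent 2) T w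
    (fun e => A e \ Tᶜ.image g) K
    (by
      intro e he hsingle
      refine hgT e he fun e' he' hc => ?_
      have hmem : e' ∈ {i ∈ T | center i = center e} := mem_filter.2 ⟨he', hc⟩
      rw [hsingle] at hmem
      exact mem_singleton.1 hmem)
    (by omega)
    (by
      intro e _
      have h1 := le_card_sdiff (Tᶜ.image g) (A e)
      have h2 : #(Tᶜ.image g) ≤ #Tᶜ := card_image_le
      rw [hA] at h1
      omega)
  have hx' : ∀ e ∈ T, x e ∈ A e ∧ ∀ e' ∉ T, g e' ≠ x e := by
    intro e he
    have := hxA e he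
    simp only [mem_sdiff, mem_image, mem_compl, not_exists, not_and] at this
    exact this
  let f : G.edgeSet → ℝ := fun e => if e ∈ T then x e else g e
  have hfT : ∀ e ∈ T, f e = x e := fun e he => if_pos he
  have hfT' : ∀ e ∉ T, f e = g e := fun e he => if_neg he
  have hsum : ∀ v, G.weightedVertexSum ω f v = w v + ∑ e ∈ T with v ∈ e.1, x e := by
    intro v
    have h1 : ∑ e ∈ T with v ∈ e.1, x e = ∑ e ∈ T with v ∈ e.1, f e :=
      sum_congr rfl fun e he => (hfT e (mem_filter.1 he).1).symm
    have h2 : ∑ e ∈ Tᶜ with v ∈ e.1, g e = ∑ e ∈ Tᶜ with v ∈ e.1, f e :=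
      sum_congr rfl fun e he => (hfT' e (mem_compl.1 (mem_filter.1 he).1)).symm
    rw [weightedVertexSum, h1]
    simp only [w]
    rw [h2, add_assoc, sum_filter, sum_filter, sum_filter, sum_compl_add_sum T]
  have hsum_leaf : ∀ e ∈ T, G.weightedVertexSum ω f (leaf e) = x e + w (leaf e) := by
    intro e he
    have : {e' ∈ T | leaf e ∈ e'.1} = {e} := by
      ext e'
      rw [mem_filter, mem_singleton]
      exact ⟨fun h' => (h.leaf_mem_iff he h'.1).1 h'.2,
        fun h' => by rw [h']; exact ⟨he, h.leaf_mem he⟩⟩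
    rw [hsum, this, sum_singleton, add_comm]
  have hsum_center : ∀ e ∈ T, G.weightedVertexSum ω f (center e) =
      w (center e) + ∑ e' ∈ T with center e' = center e, x e' := by
    intro e he
    rw [hsum, filter_congr fun e' he' => h.center_mem_iff he he']
  refine ⟨f, fun e => ?_, fun e₁ e₂ heq => ?_, fun u v huv hu hv hK2 heq => ?_⟩
  · by_cases he : e ∈ T
    · rw [hfT e he]; exact hAL e (hx' e he).1
    · rw [hfT' e he]; exact hAL e (hgA e he)
  · by_cases h₁ : e₁ ∈ T <;> by_cases h₂ : e₂ ∈ T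
    · rw [hfT _ h₁, hfT _ h₂] at heq
      exact hx.label_injOn h₁ h₂ heq
    · rw [hfT _ h₁, hfT' _ h₂] at heq
      exact absurd heq.symm ((hx' _ h₁).2 _ h₂)
    · rw [hfT' _ h₁, hfT _ h₂] at heq
      exact absurd heq ((hx' _ h₂).2 _ h₁)
    · rw [hfT' _ h₁, hfT' _ h₂] at heq
      exact hg (mem_coe.2 (mem_compl.2 h₁)) (mem_coe.2 (mem_compl.2 h₂)) heq
  · obtain ⟨e₁, h₁, hu⟩ := h.exists_mem u hu
    obtain ⟨e₂, h₂, hv⟩ := h.exists_mem v hv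
    rcases (h.mem_iff h₁).1 hu with rfl | rfl <;> rcases (h.mem_iff h₂).1 hv with rfl | rfl
    · rw [hsum_leaf _ h₁, hsum_leaf _ h₂] at heq
      exact huv (congrArg leaf (hx.leaf_injOn h₁ h₂ heq))
    · rw [hsum_leaf _ h₁, hsum_center _ h₂] at heq
      obtain ⟨hc, hex⟩ := hx.leaf_center e₁ h₁ _ (mem_image_of_mem center h₂) heq
      rw [← hc] at hex hK2
      exact hK2 ⟨h.adj h₁, by rwa [ConnectedComponent.sound (h.adj h₁).reachable]⟩
    · rw [hsum_center _ h₁, hsum_leaf _ h₂] at heq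
      obtain ⟨hc, hex⟩ := hx.leaf_center e₂ h₂ _ (mem_image_of_mem center h₁) heq.symm
      rw [← hc] at hex hK2
      exact hK2 ⟨(h.adj h₂).symm, hex⟩
    · rw [hsum_center _ h₁, hsum_center _ h₂] at heq
      exact huv (hx.center_injOn (mem_coe.2 (mem_image_of_mem center h₁))
        (mem_coe.2 (mem_image_of_mem center h₂)) heq)

/-- Without components `K_1` and `K_2`, no pair of vertices is exempt in the definition of
quasi-antimagic. -/
theorem IsListWeightedQuasiAntimagic.isListWeightedAntimagic {V : Type*} [Fintype V]
    {G : SimpleGraph V} {k : ℕ} (h : G.IsListWeightedQuasiAntimagic k)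
    (hG : ∀ c : G.ConnectedComponent, ¬ c.IsCompleteComponent 1 ∧ ¬ c.IsCompleteComponent 2) :
    G.IsListWeightedAntimagic k := by
  intro ω L hL
  obtain ⟨f, hf, hinj, hsum⟩ := h ω L hL
  exact ⟨f, hf, hinj, fun u v huv => hsum u v huv (fun hu => (hG _).1 hu.isCompleteComponent)
    (fun hv => (hG _).1 hv.isCompleteComponent) fun h' => (hG _).2 h'.2⟩

end SimpleGraph

theorem mainTheorem1 {V : Type*} [Fintype V] (G : SimpleGraph V) :
    G.IsListWeightedQuasiAntimagic (4 * Fintype.card V / 3) ∧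
    ((∀ c : G.ConnectedComponent, ¬ c.IsCompleteComponent 1 ∧ ¬ c.IsCompleteComponent 2) →
      G.IsListWeightedAntimagic (4 * Fintype.card V / 3)) := by
  exact ⟨G.isListWeightedQuasiAntimagic,
    G.isListWeightedQuasiAntimagic.isListWeightedAntimagic⟩
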